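/- Let $\Gamma_1=\{y\in\mathbb R^n: y_1>0,\dots,y_n>0\}$ and $T_{\Gamma_1}=\{x+iy: x\in\mathbb R^n,\ y\in\Gamma_1\}\subset\mathbb C^n$. Let $H^2(T_{\Gamma_1})$ be the space of holomorphic functions $F$ on $T_{\Gamma_1}$ with $$\|F\|^2=\sup_{y\in\Gamma_1}\int_{\mathbb R^n}|F(x+iy)|^2\,dx<\infty .$$ For $F\in H^2(T_{\Gamma_1})$ write $F(\xi)$, $\xi\in\mathbb R^n$, for its limit function, i.e. the limit of $F(\xi+i\eta)$ in $L^2(\mathbb R^n)$ as $\eta\to0$, $\eta\in\Gamma_1$, and put $\langle F,G\rangle=\int_{\mathbb R^n}F(\xi)\overline{G(\xi)}\,d\xi$. Let $$K(w,\overline z)=\prod_{k=1}^n\frac{-1}{2\pi i\,(w_k-\overline z_k)}$$ be the Cauchy–Szegő kernel and, for a multi-index $\alpha=(\alpha_1,\dots,\alpha_n)$ of non-negative integers and $z=x+iy\in T_{\Gamma_1}$, let $$\phi_{\alpha,z}(w)=\frac{\partial^{|\alpha|}K(w,\overline z)}{\partial x_1^{\alpha_1}\cdots\partial x_n^{\alpha_n}}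 .$$ Theorem. Let $F\in H^2(T_{\Gamma_1})$ and let $\alpha$ be a multi-index. Then the $L^2$ limit function of $F$ exists; $\phi_{\alpha,z}\in H^2(T_{\Gamma_1})$ and $\|\phi_{\alpha,z}\|>0$ for every $z\in T_{\Gamma_1}$; and $$\lim_{|x|\to\infty}\frac{|\langle F,\phi_{\alpha,z}\rangle|}{\|\phi_{\alpha,z}\|}=0,\qquad z=x+iy,$$ uniformly for $y\in\Gamma_1$: for every $\varepsilon>0$ there is an $R$ such that the ratio is less than $\varepsilon$ whenever $|x|>R$ and $y\in\Gamma_1$. -/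

import Mathlib

open MeasureTheory Filter Topology
open scoped ENNReal ComplexConjugate

noncomputable section

namespace HardyTube

variable {n : ℕ}

/-- The point `x + i y` of `ℂⁿ`. -/
def cpoint (x y : Fin n → ℝ) : Fin n → ℂ := fun j => (x j : ℂ) + (y j : ℂ) * Complex.I

/-- The first octant `Γ₁ = {y ∈ ℝⁿ : y₁ > 0, …, yₙ > 0}`. -/
def octant (n : ℕ) : Set (Fin n → ℝ) := {y | ∀ j, 0 < y j}

/-- The tube `T_B = {x + i y : x ∈ ℝⁿ, y ∈ B}` over `B ⊆ ℝⁿ`. -/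
def tube (B : Set (Fin n → ℝ)) : Set (Fin n → ℂ) := {z | (fun j => (z j).im) ∈ B}

/-- The Euclidean norm `|x|` on `ℝⁿ` (the norm of the type `Fin n → ℝ` is the maximum norm). -/
def euclNorm (x : Fin n → ℝ) : ℝ := Real.sqrt (∑ j, x j ^ 2)

/-- `sup_{y ∈ Γ₁} ∫_{ℝⁿ} |F(x + i y)|² dx`, as an extended non-negative number. -/
def h2NormSq (F : (Fin n → ℂ) → ℂ) : ℝ≥0∞ :=
  ⨆ y ∈ octant n, ∫⁻ x : Fin n → ℝ, ‖F (cpoint x y)‖ₑ ^ 2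

/-- `F ∈ H²(T_{Γ₁})`: `F` is holomorphic on `T_{Γ₁}` and
`sup_{y ∈ Γ₁} ∫_{ℝⁿ} |F(x + i y)|² dx < ∞`. Values of `F` off the tube play no role. -/
def MemH2 (F : (Fin n → ℂ) → ℂ) : Prop :=
  DifferentiableOn ℂ F (tube (octant n)) ∧ h2NormSq F < ∞

/-- The norm `‖F‖` of `H²(T_{Γ₁})`. -/
def h2Norm (F : (Fin n → ℂ) → ℂ) : ℝ := Real.sqrt (h2NormSq F).toReal

/-- `f` is the limit function of `F`: `f ∈ L²(ℝⁿ)` and `F(· + i η) → f` in the `L²`-norm as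
`η → 0`, `η ∈ Γ₁`. Such an `f` is unique up to a null set. -/
def IsLimitFunction (F : (Fin n → ℂ) → ℂ) (f : (Fin n → ℝ) → ℂ) : Prop :=
  MemLp f 2 volume ∧
    Tendsto (fun η : Fin n → ℝ => eLpNorm (fun ξ => F (cpoint ξ η) - f ξ) 2 volume)
      (𝓝[octant n] 0) (𝓝 0)

open Classical in
/-- The limit function `F(ξ)`, `ξ ∈ ℝⁿ` (and `0` if `F` has no limit function). -/
def limitFunction (F : (Fin n → ℂ) → ℂ) : (Fin n → ℝ) → ℂ :=
  if h : ∃ f, IsLimitFunction F f then h.choose else 0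

/-- The inner product `⟨F, G⟩ = ∫_{ℝⁿ} F(ξ) conj(G(ξ)) dξ` of `H²(T_{Γ₁})`. -/
def h2Inner (F G : (Fin n → ℂ) → ℂ) : ℂ :=
  ∫ ξ : Fin n → ℝ, limitFunction F ξ * conj (limitFunction G ξ)

/-- The Cauchy–Szegő kernel `K(w, ζ) = ∏ₖ -1 / (2πi (wₖ - ζₖ))`, used with `ζ` the conjugate of
a point of the tube. -/
def szegoKernel (w ζ : Fin n → ℂ) : ℂ :=
  ∏ k, (-1) / (2 * (Real.pi : ℂ) * Complex.I * (w k - ζ k))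

/-- The partial derivative `∂g/∂xⱼ`. -/
def partialX (j : Fin n) (g : (Fin n → ℝ) → ℂ) : (Fin n → ℝ) → ℂ :=
  fun x => deriv (fun t : ℝ => g (Function.update x j t)) (x j)

/-- The derivative `∂^{|α|} g / ∂x₁^{α₁} ⋯ ∂xₙ^{αₙ}`. -/
def multiPartial (α : Fin n → ℕ) (g : (Fin n → ℝ) → ℂ) : (Fin n → ℝ) → ℂ :=
  (List.finRange n).foldr (fun j h => (partialX j)^[α j] h) g

/-- `φ_{α,z}(w)`: the derivative of order `α` of `K(w, conj z)`, `z = x + i y`, with respect to the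
real part `x` of `z`. -/
def phi (α : Fin n → ℕ) (z w : Fin n → ℂ) : ℂ :=
  multiPartial α
    (fun x => szegoKernel w (fun j => conj (cpoint x (fun k => (z k).im) j)))
    (fun j => (z j).re)

end HardyTube

end

namespace HardyTube

/-! ### Hilbert space families whose inner products depend only on the sum of the parameters. -/

section Hilbert

variable {n : ℕ} {H : Type*} [NormedAddCommGroup H] [InnerProductSpace ℂ H]

/-! Existence of the limit function is a Hilbert space argument. Let `Φ y` be the slice `F(· + iy)`
in `L²`. Cauchy's theorem, applied one coordinate at a time, shows that `⟨Φ y, Φ y'⟩` depends only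
on `y + y'` (`MemH2.integral_shift`). Hence, with `m` the midpoint of `y` and `y'`, `‖Φ y - Φ y'‖² =
‖Φ y‖² - 2‖Φ m‖² + ‖Φ y'‖²`. So `‖Φ‖²` is midpoint convex; being bounded, it cannot increase in
nonnegative directions, and near the vertex it is close to its supremum. The identity then makes `Φ`
Cauchy at `0` (`InnerShift.exists_tendsto`).

For the decay, `φ_{α,z}` is an explicit product of one-variable kernels, and its boundary function
has squared modulus a product of `C / ((ξ - x)² + y²)^(a+1)`. If `|x|` is large, some coordinate of
`x` is large, and the mass of that factor on a fixed interval is a small fraction of its total mass,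
uniformly in the height (`setLIntegral_kernelSq_le`); by Tonelli the same holds for the product on a
cube. Choose the cube so that the limit function of `F` has small `L²` mass outside it.
Cauchy–Schwarz on the cube and on its complement bounds the inner product by a small multiple of
`‖φ_{α,z}‖` (`norm_h2Inner_phi_le`). -/

theorem add_mem_octant {y d : Fin n → ℝ} (hy : y ∈ octant n) (hd : 0 ≤ d) : y + d ∈ octant n :=
  fun j => add_pos_of_pos_of_nonneg (hy j) (hd j)

/-- `⟨Φ y, Φ y'⟩` depends only on the sum `y + y'`: the shift along one coordinate axis. -/
def InnerShift (Φ : (Fin n → ℝ) → H) : Prop :=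
  ∀ (j : Fin n) (t : ℝ), 0 ≤ t → ∀ y ∈ octant n, ∀ y' ∈ octant n,
    inner ℂ (Φ (y + Pi.single j t)) (Φ y') = inner ℂ (Φ y) (Φ (y' + Pi.single j t))

theorem InnerShift.add {Φ : (Fin n → ℝ) → H} (h : InnerShift Φ) {y y' d : Fin n → ℝ}
    (hy : y ∈ octant n) (hy' : y' ∈ octant n) (hd : 0 ≤ d) :
    inner ℂ (Φ (y + d)) (Φ y') = inner ℂ (Φ y) (Φ (y' + d)) := by
  have key : ∀ s : Finset (Fin n), ∀ y ∈ octant n, ∀ y' ∈ octant n,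
      inner ℂ (Φ (y + ∑ j ∈ s, Pi.single j (d j))) (Φ y')
        = inner ℂ (Φ y) (Φ (y' + ∑ j ∈ s, Pi.single j (d j))) := by
    intro s
    induction s using Finset.induction_on with
    | empty => intro y _ y' _; simp
    | insert a s ha ih =>
      intro y hy y' hy'
      have hs : 0 ≤ Pi.single (M := fun _ => ℝ) a (d a) := Pi.single_nonneg.2 (hd a)
      rw [Finset.sum_insert ha, ← add_assoc, ih _ (add_mem_octant hy hs) _ hy',
        h a (d a) (hd a) y hy _ (add_mem_octant hy' (Finset.sum_nonneg fun j _ =>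
          Pi.single_nonneg.2 (hd j))), add_assoc, add_comm (∑ j ∈ s, _)]
  simpa [Finset.univ_sum_single] using key Finset.univ y hy y' hy'

theorem midpoint_mem_octant {y y' : Fin n → ℝ} (hy : y ∈ octant n) (hy' : y' ∈ octant n) :
    (1 / 2 : ℝ) • (y + y') ∈ octant n := fun j => by
  have := hy j; have := hy' j
  simp only [Pi.smul_apply, Pi.add_apply, smul_eq_mul]; linarith

/-- Both `y` and the midpoint `m` lie above a common point `c` of the octant. Moving the excess over
`c` to the other argument turns `⟨Φ y, Φ y'⟩` and `⟨Φ m, Φ m⟩` into the same product `⟨Φ c, Φ (2m -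
c)⟩`. -/
theorem InnerShift.inner_eq {Φ : (Fin n → ℝ) → H} (h : InnerShift Φ) {y y' : Fin n → ℝ}
    (hy : y ∈ octant n) (hy' : y' ∈ octant n) :
    inner ℂ (Φ y) (Φ y') = (‖Φ ((1 / 2 : ℝ) • (y + y'))‖ ^ 2 : ℝ) := by
  set m := (1 / 2 : ℝ) • (y + y') with hm
  have hmem : m ∈ octant n := midpoint_mem_octant hy hy'
  set c := (1 / 2 : ℝ) • (y ⊓ y') with hc
  have hcj : ∀ j, c j = 1 / 2 * min (y j) (y' j) := fun j => rfl
  have hmj : ∀ j, m j = 1 / 2 * (y j + y' j) := fun j => rfl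
  have hc0 : c ∈ octant n := fun j => by
    rw [hcj]; have := lt_min (hy j) (hy' j); linarith
  have hd : 0 ≤ y - c := fun j => by
    have := hy j; have := hc0 j; rw [hcj] at this
    have := min_le_left (y j) (y' j)
    simp only [Pi.zero_apply, Pi.sub_apply, hcj]; linarith
  have he : 0 ≤ m - c := fun j => by
    have := hy j; have := hy' j
    have := min_le_left (y j) (y' j)
    simp only [Pi.zero_apply, Pi.sub_apply, hcj, hmj]; linarith
  have h1 := h.add hc0 hy' hd
  have h2 := h.add hc0 hmem he
  have e : y' + (y - c) = m + (m - c) := by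
    ext j; simp only [Pi.add_apply, Pi.sub_apply, hmj]; ring
  rw [add_sub_cancel] at h1 h2
  rw [h1, e, ← h2, inner_self_eq_norm_sq_to_K]
  norm_cast

theorem InnerShift.norm_sub_sq {Φ : (Fin n → ℝ) → H} (h : InnerShift Φ) {y y' : Fin n → ℝ}
    (hy : y ∈ octant n) (hy' : y' ∈ octant n) :
    ‖Φ y - Φ y'‖ ^ 2
      = ‖Φ y‖ ^ 2 - 2 * ‖Φ ((1 / 2 : ℝ) • (y + y'))‖ ^ 2 + ‖Φ y'‖ ^ 2 := by
  rw [_root_.norm_sub_sq (𝕜 := ℂ), h.inner_eq hy hy']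
  simp only [RCLike.re_to_complex, Complex.ofReal_re]

/-- Along the ray `y + k d` the squared norms form a convex sequence, because `norm_sub_sq` has a
nonnegative left side. A convex sequence with a positive first increment grows at least linearly,
against the bound `C`. -/
theorem InnerShift.norm_sq_add_le {Φ : (Fin n → ℝ) → H} (h : InnerShift Φ) {C : ℝ}
    (hC : ∀ y ∈ octant n, ‖Φ y‖ ^ 2 ≤ C) {y d : Fin n → ℝ}
    (hy : y ∈ octant n) (hd : 0 ≤ d) : ‖Φ (y + d)‖ ^ 2 ≤ ‖Φ y‖ ^ 2 := by
  set a : ℕ → ℝ := fun k => ‖Φ (y + (k : ℝ) • d)‖ ^ 2 with ha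
  have hmem : ∀ k : ℕ, y + (k : ℝ) • d ∈ octant n := fun k =>
    add_mem_octant hy (smul_nonneg k.cast_nonneg hd)
  have hconv : ∀ k, a (k + 1) - a k ≤ a (k + 2) - a (k + 1) := by
    intro k
    have h1 := h.norm_sub_sq (hmem k) (hmem (k + 2))
    have e : (1 / 2 : ℝ) • (y + (k : ℝ) • d + (y + ((k + 2 : ℕ) : ℝ) • d))
        = y + ((k + 1 : ℕ) : ℝ) • d := by
      ext j; simp only [Pi.add_apply, Pi.smul_apply, smul_eq_mul]; push_cast; ring
    rw [e] at h1
    have := sq_nonneg ‖Φ (y + (k : ℝ) • d) - Φ (y + ((k + 2 : ℕ) : ℝ) • d)‖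
    simp only [ha]; linarith
  have hinc : ∀ k, a 1 - a 0 ≤ a (k + 1) - a k := by
    intro k
    induction k with
    | zero => exact le_rfl
    | succ k ih => exact ih.trans (hconv k)
  have hlin : ∀ k : ℕ, a 0 + k * (a 1 - a 0) ≤ a k := by
    intro k
    induction k with
    | zero => simp
    | succ k ih => have := hinc k; push_cast; linarith
  have e1 : a 1 = ‖Φ (y + d)‖ ^ 2 := by simp [ha]
  have e0 : a 0 = ‖Φ y‖ ^ 2 := by simp [ha]
  by_contra! hlt
  have hpos : 0 < a 1 - a 0 := by rw [e1, e0]; linarith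
  obtain ⟨k, hk⟩ := exists_lt_nsmul hpos (C - a 0)
  have h1 := hlin k
  have h2 := hC _ (hmem k)
  rw [nsmul_eq_mul] at hk
  simp only [ha] at *
  linarith

theorem octant_nhdsWithin_neBot (n : ℕ) : (𝓝[octant n] (0 : Fin n → ℝ)).NeBot := by
  rw [← mem_closure_iff_nhdsWithin_neBot]
  refine mem_closure_of_tendsto (b := atTop)
    (f := fun k : ℕ => fun _ : Fin n => (1 : ℝ) / ((k : ℝ) + 1)) ?_ (Eventually.of_forall ?_)
  · exact tendsto_pi_nhds.2 fun _ => tendsto_one_div_add_atTop_nhds_zero_nat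
  · intro k j; positivity

theorem InnerShift.exists_tendsto [CompleteSpace H] {Φ : (Fin n → ℝ) → H} (h : InnerShift Φ)
    {C : ℝ} (hC : ∀ y ∈ octant n, ‖Φ y‖ ^ 2 ≤ C) :
    ∃ f, Tendsto Φ (𝓝[octant n] 0) (𝓝 f) := by
  have := octant_nhdsWithin_neBot n
  set S : Set ℝ := (fun y => ‖Φ y‖ ^ 2) '' octant n with hS
  have hne : S.Nonempty := ⟨_, fun _ => (1 : ℝ), fun _ => one_pos, rfl⟩
  have hbd : BddAbove S := ⟨C, by rintro _ ⟨y, hy, rfl⟩; exact hC y hy⟩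
  have hle : ∀ y ∈ octant n, ‖Φ y‖ ^ 2 ≤ sSup S := fun y hy => le_csSup hbd ⟨y, hy, rfl⟩
  refine CompleteSpace.complete (f := map Φ (𝓝[octant n] 0)) ?_
  rw [Metric.cauchy_iff]
  refine ⟨inferInstance, fun ε hε => ?_⟩
  -- Below `y0` all squared norms, midpoints included, exceed `sSup S - ε² / 2`, so the midpoint
  -- identity gives a squared distance less than `2 sSup S - 2 (sSup S - ε² / 2) = ε²`.
  obtain ⟨_, ⟨y0, hy0, rfl⟩, hlt⟩ :=
    exists_lt_of_lt_csSup hne (show sSup S - ε ^ 2 / 2 < sSup S by nlinarith)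
  have hU : {y : Fin n → ℝ | ∀ j, y j < y0 j} ∈ 𝓝 (0 : Fin n → ℝ) := by
    have : {y : Fin n → ℝ | ∀ j, y j < y0 j} = ⋂ j, {y | y j < y0 j} := by ext; simp
    rw [this]
    exact (isOpen_iInter_of_finite fun j =>
      isOpen_lt (continuous_apply j) continuous_const).mem_nhds
        (Set.mem_iInter.2 fun j => hy0 j)
  refine ⟨Φ '' ({y | ∀ j, y j < y0 j} ∩ octant n),
    image_mem_map (Filter.inter_mem (mem_nhdsWithin_of_mem_nhds hU) self_mem_nhdsWithin), ?_⟩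
  rintro _ ⟨y, ⟨hy1, hy⟩, rfl⟩ _ ⟨y', ⟨hy1', hy'⟩, rfl⟩
  set m := (1 / 2 : ℝ) • (y + y') with hm
  have hmem : m ∈ octant n := midpoint_mem_octant hy hy'
  have hd : 0 ≤ y0 - m := fun j => by
    have := hy1 j; have := hy1' j
    simp only [hm, Pi.zero_apply, Pi.sub_apply, Pi.smul_apply, Pi.add_apply, smul_eq_mul]
    linarith
  have h1 := h.norm_sq_add_le hC hmem hd
  rw [add_sub_cancel] at h1
  have h2 := h.norm_sub_sq hy hy'
  have h3 := hle y hy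
  have h4 := hle y' hy'
  rw [dist_eq_norm]
  refine lt_of_pow_lt_pow_left₀ 2 hε.le ?_
  simp only at hlt
  rw [h2]
  linarith

end Hilbert

end HardyTube

namespace HardyTube

/-! ### Shifting a horizontal contour in one variable. -/

section Contour

open Complex Set

/-- If `f` tends to `L` at infinity and is dominated by an integrable function, then `L = 0`. -/
theorem eq_zero_of_tendsto_of_norm_le_integrable {E : Type*} [NormedAddCommGroup E] {f : ℝ → E}
    {u : ℝ → ℝ} {L : E} (hf : Tendsto f atTop (𝓝 L)) (hu : Integrable u)
    (hle : ∀ᶠ T in atTop, ‖f T‖ ≤ u T) : L = 0 := by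
  by_contra hL
  have hL' : 0 < ‖L‖ := norm_pos_iff.2 hL
  obtain ⟨T0, hT0⟩ := eventually_atTop.1
    (((hf.norm.eventually (lt_mem_nhds (half_lt_self hL'))).and hle))
  have hint : IntegrableOn (fun _ : ℝ => ‖L‖ / 2) (Ioi T0) := by
    refine Integrable.mono' (g := u) hu.integrableOn aestronglyMeasurable_const ?_
    refine (ae_restrict_iff' measurableSet_Ioi).2 (Eventually.of_forall fun T hT => ?_)
    obtain ⟨h1, h2⟩ := hT0 T (le_of_lt hT)
    rw [Real.norm_of_nonneg (by positivity)]
    linarith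
  rw [integrableOn_const_iff] at hint
  rcases hint with h | h
  · rw [enorm_eq_zero] at h; linarith
  · simp at h

/-- Pointwise decay of `g` is not required. By Cauchy on rectangles, the truncated difference is
bounded by the integrals over the two vertical sides, and these are integrable as functions of the
abscissa `T`. The difference converges as `T → ∞`, so its limit must be `0`. -/
theorem integral_horizontal_eq {g : ℂ → ℂ} {t : ℝ} (ht : 0 ≤ t)
    (hd : DifferentiableOn ℂ g (univ ×ℂ Icc 0 t))
    (hI : Integrable (fun p : ℝ × ℝ => g (p.1 + p.2 * I))
      ((volume : Measure ℝ).prod (volume.restrict (Ioc 0 t))))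
    (h0 : Integrable fun x : ℝ => g x) (h1 : Integrable fun x : ℝ => g (x + t * I)) :
    ∫ x : ℝ, g x = ∫ x : ℝ, g (x + t * I) := by
  set h : ℝ → ℝ := fun T => ∫ s in Ioc 0 t, ‖g (T + s * I)‖ with hh
  have hint : Integrable h := hI.norm.integral_prod_left
  have hu : Integrable fun T => h T + h (-T) := hint.add hint.comp_neg
  have e0 := intervalIntegral_tendsto_integral h0 tendsto_neg_atTop_atBot tendsto_id
  have e1 := intervalIntegral_tendsto_integral h1 tendsto_neg_atTop_atBot tendsto_id
  refine sub_eq_zero.1 (eq_zero_of_tendsto_of_norm_le_integrable (e0.sub e1) hu ?_)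
  refine Eventually.of_forall fun T => ?_
  have key := integral_boundary_rect_eq_zero_of_differentiableOn g ((-T : ℝ) : ℂ)
    ((T : ℝ) + (t : ℝ) * I) (hd.mono ?_)
  · simp only [ofReal_re, ofReal_im, add_re, add_im, mul_re, mul_im, I_re, I_im, mul_zero,
      mul_one, sub_zero, add_zero, zero_add, ofReal_zero, zero_mul, smul_eq_mul] at key
    have e : (∫ x in -T..T, g x) - ∫ x in -T..T, g (x + t * I)
        = I * (∫ s in (0 : ℝ)..t, g (((-T : ℝ) : ℂ) + s * I))
          - I * ∫ s in (0 : ℝ)..t, g (T + s * I) := by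
      linear_combination key
    simp only [id]
    rw [e, intervalIntegral.integral_of_le ht, intervalIntegral.integral_of_le ht]
    refine (norm_sub_le _ _).trans ?_
    rw [norm_mul, norm_mul, norm_I, one_mul, one_mul, add_comm]
    exact add_le_add (norm_integral_le_integral_norm _) (norm_integral_le_integral_norm _)
  · intro z hz
    refine ⟨mem_univ _, ?_⟩
    have := hz.2
    simpa [uIcc_of_le ht] using this

end Contour

/-! ### Slices of a Hardy function: continuity and integrability. -/

section Tube

variable {n : ℕ} {F : (Fin n → ℂ) → ℂ}

theorem cpoint_mem_tube {x y : Fin n → ℝ} {B : Set (Fin n → ℝ)} :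
    cpoint x y ∈ tube B ↔ y ∈ B := by
  have : (fun j => (cpoint x y j).im) = y := by ext j; simp [cpoint]
  simp only [tube, Set.mem_ofPred_eq, this]

theorem isOpen_tube_octant (n : ℕ) : IsOpen (tube (octant n)) := by
  have : tube (octant n) = ⋂ j, {z : Fin n → ℂ | 0 < (z j).im} := by
    ext z; simp [tube, octant]
  rw [this]
  exact isOpen_iInter_of_finite fun j => isOpen_lt continuous_const (by fun_prop)

theorem continuous_cpoint : Continuous fun p : (Fin n → ℝ) × (Fin n → ℝ) => cpoint p.1 p.2 := by
  unfold cpoint; fun_prop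

theorem MemH2.continuous_slice (hF : MemH2 F) {y : Fin n → ℝ} (hy : y ∈ octant n) :
    Continuous fun x => F (cpoint x y) :=
  hF.1.continuousOn.comp_continuous
    (continuous_cpoint.comp (Continuous.prodMk continuous_id continuous_const))
    fun _ => cpoint_mem_tube.2 hy

theorem eLpNorm_two_sq {α : Type*} [MeasurableSpace α] (μ : Measure α) (f : α → ℂ) :
    eLpNorm f 2 μ ^ 2 = ∫⁻ x, ‖f x‖ₑ ^ 2 ∂μ := by
  have := eLpNorm_nnreal_pow_eq_lintegral (μ := μ) (f := f) (p := 2) two_ne_zero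
  simpa using this

theorem lintegral_slice_le (F : (Fin n → ℂ) → ℂ) {y : Fin n → ℝ} (hy : y ∈ octant n) :
    ∫⁻ x : Fin n → ℝ, ‖F (cpoint x y)‖ₑ ^ 2 ≤ h2NormSq F :=
  le_iSup₂ (f := fun y (_ : y ∈ octant n) => ∫⁻ x : Fin n → ℝ, ‖F (cpoint x y)‖ₑ ^ 2) y hy

theorem MemH2.memLp_slice (hF : MemH2 F) {y : Fin n → ℝ} (hy : y ∈ octant n) :
    MemLp (fun x => F (cpoint x y)) 2 volume := by
  refine ⟨(hF.continuous_slice hy).aestronglyMeasurable, ?_⟩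
  have h := (lintegral_slice_le F hy).trans_lt hF.2
  rw [← eLpNorm_two_sq] at h
  by_contra htop
  rw [not_lt, top_le_iff] at htop
  simp [htop] at h

theorem enorm_mul_conj_le (a b : ℂ) : ‖a * conj b‖ₑ ≤ ‖a‖ₑ ^ 2 + ‖b‖ₑ ^ 2 := by
  have hb : ‖conj b‖ₑ = ‖b‖ₑ := by simp [← ofReal_norm]
  rw [enorm_mul, hb]
  rcases le_total ‖a‖ₑ ‖b‖ₑ with h | h
  · calc ‖a‖ₑ * ‖b‖ₑ ≤ ‖b‖ₑ * ‖b‖ₑ := by gcongr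
      _ = ‖b‖ₑ ^ 2 := (sq _).symm
      _ ≤ _ := le_add_self
  · calc ‖a‖ₑ * ‖b‖ₑ ≤ ‖a‖ₑ * ‖a‖ₑ := by gcongr
      _ = ‖a‖ₑ ^ 2 := (sq _).symm
      _ ≤ _ := le_self_add

theorem add_single_mem_octant {y : Fin n → ℝ} (hy : y ∈ octant n) (j : Fin n) {t : ℝ}
    (ht : 0 ≤ t) : y + Pi.single j t ∈ octant n :=
  add_mem_octant hy (Pi.single_nonneg.2 ht)

theorem MemH2.continuousOn_strip (hF : MemH2 F) {y y' : Fin n → ℝ} (hy : y ∈ octant n)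
    (hy' : y' ∈ octant n) (j : Fin n) (t : ℝ) :
    ContinuousOn (fun p : (Fin n → ℝ) × ℝ => F (cpoint p.1 (y + Pi.single j p.2)) *
        conj (F (cpoint p.1 (y' + Pi.single j (t - p.2))))) (Set.univ ×ˢ Set.Ioc 0 t) := by
  have hc1 : Continuous fun p : (Fin n → ℝ) × ℝ =>
      cpoint p.1 (y + Pi.single (M := fun _ => ℝ) j p.2) :=
    continuous_cpoint.comp (continuous_fst.prodMk
      (continuous_const.add ((continuous_single (A := fun _ => ℝ) j).comp continuous_snd)))
  have hc2 : Continuous fun p : (Fin n → ℝ) × ℝ =>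
      cpoint p.1 (y' + Pi.single (M := fun _ => ℝ) j (t - p.2)) :=
    continuous_cpoint.comp (continuous_fst.prodMk
      (continuous_const.add ((continuous_single (A := fun _ => ℝ) j).comp
        (continuous_const.sub continuous_snd))))
  refine ContinuousOn.mul (hF.1.continuousOn.comp hc1.continuousOn ?_)
    (Complex.continuous_conj.comp_continuousOn (hF.1.continuousOn.comp hc2.continuousOn ?_))
  · exact fun p hp => cpoint_mem_tube.2 (add_single_mem_octant hy j hp.2.1.le)
  · exact fun p hp => cpoint_mem_tube.2 (add_single_mem_octant hy' j (sub_nonneg.2 hp.2.2))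

theorem integrable_prod_Ioc_of_lintegral_le {Q : (Fin n → ℝ) × ℝ → ℂ} {t : ℝ} {C : ℝ≥0∞}
    (hC : C < ∞) (hcont : ContinuousOn Q (Set.univ ×ˢ Set.Ioc 0 t))
    (hle : ∀ s ∈ Set.Ioc 0 t, ∫⁻ x, ‖Q (x, s)‖ₑ ≤ C) :
    Integrable Q ((volume : Measure (Fin n → ℝ)).prod (volume.restrict (Set.Ioc 0 t))) := by
  have hmeas : AEStronglyMeasurable Q
      ((volume : Measure (Fin n → ℝ)).prod (volume.restrict (Set.Ioc 0 t))) := by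
    have := hcont.aestronglyMeasurable (μ := (volume : Measure (Fin n → ℝ)).prod volume)
      (MeasurableSet.univ.prod measurableSet_Ioc)
    rwa [← Measure.prod_restrict, Measure.restrict_univ] at this
  refine ⟨hmeas, ?_⟩
  rw [HasFiniteIntegral, lintegral_prod_symm _ hmeas.enorm]
  calc _ ≤ ∫⁻ _ in Set.Ioc 0 t, C :=
        lintegral_mono_ae ((ae_restrict_iff' measurableSet_Ioc).2 (Eventually.of_forall hle))
    _ < ∞ := by
        rw [lintegral_const]
        exact ENNReal.mul_lt_top hC (by simp)

theorem MemH2.lintegral_mul_conj_le (hF : MemH2 F) {y y' : Fin n → ℝ} (hy : y ∈ octant n)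
    (hy' : y' ∈ octant n) :
    ∫⁻ x, ‖F (cpoint x y) * conj (F (cpoint x y'))‖ₑ ≤ h2NormSq F + h2NormSq F := by
  refine (lintegral_mono fun x => enorm_mul_conj_le _ _).trans ?_
  rw [lintegral_add_left ((hF.continuous_slice hy).measurable.enorm.pow_const _)]
  exact add_le_add (lintegral_slice_le F hy) (lintegral_slice_le F hy')

theorem MemH2.integrable_mul_conj (hF : MemH2 F) {y y' : Fin n → ℝ} (hy : y ∈ octant n)
    (hy' : y' ∈ octant n) :
    Integrable fun x => F (cpoint x y) * conj (F (cpoint x y')) :=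
  ⟨((hF.continuous_slice hy).mul
    (Complex.continuous_conj.comp (hF.continuous_slice hy'))).aestronglyMeasurable,
    (hF.lintegral_mul_conj_le hy hy').trans_lt (ENNReal.add_lt_top.2 ⟨hF.2, hF.2⟩)⟩

/-- Every slice at height `s` has integral at most twice `h2NormSq F`, and `s` ranges over a bounded
interval. This supplies the strip integrability that the contour shift needs on almost every line.
-/
theorem MemH2.integrable_strip (hF : MemH2 F) {y y' : Fin n → ℝ} (hy : y ∈ octant n)
    (hy' : y' ∈ octant n) (j : Fin n) (t : ℝ) :
    Integrable (fun p : (Fin n → ℝ) × ℝ => F (cpoint p.1 (y + Pi.single j p.2)) *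
        conj (F (cpoint p.1 (y' + Pi.single j (t - p.2)))))
      ((volume : Measure (Fin n → ℝ)).prod (volume.restrict (Set.Ioc 0 t))) := by
  have hcont := hF.continuousOn_strip hy hy' j t
  refine integrable_prod_Ioc_of_lintegral_le (C := h2NormSq F + h2NormSq F) ?_ hcont ?_
  · exact ENNReal.add_lt_top.2 ⟨hF.2, hF.2⟩
  · intro s hs
    have h := hF.lintegral_mul_conj_le (add_single_mem_octant hy j hs.1.le)
        (add_single_mem_octant hy' j (sub_nonneg.2 hs.2))
    exact h

end Tube

/-! ### The contour shift along one coordinate of the tube. -/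

section Shift

open Complex

variable {m : ℕ} {F : (Fin (m + 1) → ℂ) → ℂ}

theorem cpoint_insertNth (j : Fin (m + 1)) (ξ s : ℝ) (x : Fin m → ℝ) (y : Fin (m + 1) → ℝ) :
    cpoint (j.insertNth ξ x : Fin (m + 1) → ℝ) (y + Pi.single j s)
      = (j.insertNth ((ξ + s * I) + y j * I) (cpoint x (j.removeNth y)) : Fin (m + 1) → ℂ) := by
  ext k
  refine Fin.succAboveCases j ?_ (fun k => ?_) k
  · simp [cpoint]; ring
  · simp [cpoint, Fin.removeNth, Fin.succAbove_ne]

theorem differentiable_insertNth (j : Fin (m + 1)) (c : ℂ) (v : Fin m → ℂ) :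
    Differentiable ℂ fun ζ : ℂ => (j.insertNth (ζ + c) v : Fin (m + 1) → ℂ) := by
  rw [differentiable_pi]
  intro k
  refine Fin.succAboveCases j ?_ (fun k => ?_) k
  · simp only [Fin.insertNth_apply_same]; fun_prop
  · simp only [Fin.insertNth_apply_succAbove]; fun_prop

theorem insertNth_mem_tube {j : Fin (m + 1)} {ζ : ℂ} (hζ : 0 < ζ.im) {x : Fin m → ℝ}
    {y : Fin (m + 1) → ℝ} (hy : y ∈ octant (m + 1)) :
    (j.insertNth ζ (cpoint x (j.removeNth y)) : Fin (m + 1) → ℂ) ∈ tube (octant (m + 1)) := by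
  intro k
  refine Fin.succAboveCases j ?_ (fun k => ?_) k
  · simpa using hζ
  · simpa [cpoint, Fin.removeNth] using hy (j.succAbove k)

theorem MemH2.differentiableAt_line (hF : MemH2 F) {y : Fin (m + 1) → ℝ}
    (hy : y ∈ octant (m + 1)) (j : Fin (m + 1)) (x : Fin m → ℝ) {c : ℝ} {ζ : ℂ}
    (hζ : 0 < ζ.im + c) :
    DifferentiableAt ℂ
      (fun ζ : ℂ => F (j.insertNth (ζ + c * I) (cpoint x (j.removeNth y)))) ζ := by
  have hmem : (j.insertNth (ζ + c * I) (cpoint x (j.removeNth y)) : Fin (m + 1) → ℂ)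
      ∈ tube (octant (m + 1)) := insertNth_mem_tube (by simpa using hζ) hy
  exact DifferentiableAt.comp ζ
    ((hF.1 _ hmem).differentiableAt ((isOpen_tube_octant _).mem_nhds hmem))
    (differentiable_insertNth j _ _ ζ)

/-- The product `F(ζ + i y) conj (F(conj ζ + i (y' + t)))` on a line parallel to the `j`-th axis. -/
def stripProduct (F : (Fin (m + 1) → ℂ) → ℂ) (j : Fin (m + 1)) (y y' : Fin (m + 1) → ℝ) (t : ℝ)
    (x : Fin m → ℝ) (ζ : ℂ) : ℂ :=
  F (j.insertNth (ζ + (y j : ℝ) * I) (cpoint x (j.removeNth y))) *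
    conj (F (j.insertNth (conj ζ + ((y' j + t : ℝ) : ℂ) * I) (cpoint x (j.removeNth y'))))

theorem stripProduct_apply (j : Fin (m + 1)) (y y' : Fin (m + 1) → ℝ) (t ξ s : ℝ)
    (x : Fin m → ℝ) :
    stripProduct F j y y' t x (ξ + s * I) =
      F (cpoint (j.insertNth ξ x : Fin (m + 1) → ℝ) (y + Pi.single j s)) *
        conj (F (cpoint (j.insertNth ξ x : Fin (m + 1) → ℝ) (y' + Pi.single j (t - s)))) := by
  have e : conj ((ξ : ℂ) + s * I) + ((y' j + t : ℝ) : ℂ) * I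
      = (ξ + ((t - s : ℝ) : ℂ) * I) + y' j * I := by
    simp only [map_add, map_mul, conj_ofReal, conj_I]; push_cast; ring
  rw [cpoint_insertNth, cpoint_insertNth, stripProduct, e]

/-- The second factor is conjugated both inside and outside, so it is holomorphic. The heights `ζ.im
+ y j` and `y' j + t - ζ.im` stay positive on the closed strip. -/
theorem MemH2.differentiableOn_stripProduct (hF : MemH2 F) {y y' : Fin (m + 1) → ℝ}
    (hy : y ∈ octant (m + 1)) (hy' : y' ∈ octant (m + 1)) (j : Fin (m + 1)) (t : ℝ)
    (x : Fin m → ℝ) :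
    DifferentiableOn ℂ (stripProduct F j y y' t x) (Set.univ ×ℂ Set.Icc 0 t) := by
  rintro ζ ⟨-, h0, h1⟩
  have hyj := hy j
  have hyj' := hy' j
  refine DifferentiableAt.differentiableWithinAt (DifferentiableAt.mul ?_ ?_)
  · exact hF.differentiableAt_line hy j x (by linarith)
  · have := (hF.differentiableAt_line hy' j x (c := y' j + t) (ζ := conj ζ)
      (by rw [conj_im]; linarith)).conj_conj
    rw [Complex.conj_conj] at this
    exact this

theorem MemH2.integral_shift (hF : MemH2 F) {y y' : Fin (m + 1) → ℝ}
    (hy : y ∈ octant (m + 1)) (hy' : y' ∈ octant (m + 1)) (j : Fin (m + 1)) {t : ℝ}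
    (ht : 0 ≤ t) :
    ∫ x, F (cpoint x (y + Pi.single j t)) * conj (F (cpoint x y'))
      = ∫ x, F (cpoint x y) * conj (F (cpoint x (y' + Pi.single j t))) := by
  set Q : (Fin (m + 1) → ℝ) → ℝ → ℂ := fun x s => F (cpoint x (y + Pi.single j s)) *
        conj (F (cpoint x (y' + Pi.single j (t - s)))) with hQ
  set e : ℝ × (Fin m → ℝ) ≃ᵐ (Fin (m + 1) → ℝ) :=
    (MeasurableEquiv.piFinSuccAbove (fun _ => ℝ) j).symm with he
  have hem : MeasurePreserving e :=
    (volume_preserving_piFinSuccAbove (fun _ : Fin (m + 1) => ℝ) j).symm _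
  have hea : ∀ ξ x, e (ξ, x) = j.insertNth ξ x := fun _ _ => rfl
  have hslice : ∀ s ∈ Set.Icc 0 t, Integrable fun x => Q x s := fun s hs =>
    hF.integrable_mul_conj (add_single_mem_octant hy j hs.1)
      (add_single_mem_octant hy' j (sub_nonneg.2 hs.2))
  have hslice' : ∀ s ∈ Set.Icc 0 t,
      Integrable (fun p : ℝ × (Fin m → ℝ) => Q (e p) s) (volume.prod volume) := fun s hs =>
    hem.integrable_comp_of_integrable (hslice s hs)
  have hfub : ∀ s ∈ Set.Icc 0 t, ∫ x, Q x s = ∫ x, ∫ ξ, Q (e (ξ, x)) s := fun s hs => by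
    rw [← hem.integral_comp e.measurableEmbedding fun x => Q x s]
    exact integral_prod_symm _ (hslice' s hs)
  have hae : ∀ s ∈ Set.Icc 0 t, ∀ᵐ x : Fin m → ℝ, Integrable fun ξ => Q (e (ξ, x)) s :=
    fun s hs => (hslice' s hs).prod_left_ae
  -- The remaining coordinates are put first, so that Fubini yields integrability over the
  -- two-dimensional strip for almost every choice of them.
  have hstrip : Integrable (fun p : (Fin m → ℝ) × (ℝ × ℝ) => Q (e (p.2.1, p.1)) p.2.2)
      ((volume : Measure (Fin m → ℝ)).prod
        ((volume : Measure ℝ).prod (volume.restrict (Set.Ioc 0 t)))) := by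
    have h1 := (hem.prod (MeasurePreserving.id (volume.restrict (Set.Ioc (0 : ℝ) t)))).comp
      ((Measure.measurePreserving_swap (μ := (volume : Measure (Fin m → ℝ)))
        (ν := (volume : Measure ℝ))).prod
        (MeasurePreserving.id (volume.restrict (Set.Ioc (0 : ℝ) t))))
    have h2 := h1.comp ((measurePreserving_prodAssoc (volume : Measure (Fin m → ℝ))
      (volume : Measure ℝ) (volume.restrict (Set.Ioc (0 : ℝ) t))).symm _)
    exact h2.integrable_comp_of_integrable (hF.integrable_strip hy hy' j t)
  have h0t : (0 : ℝ) ∈ Set.Icc 0 t := ⟨le_rfl, ht⟩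
  have htt : t ∈ Set.Icc 0 t := ⟨ht, le_rfl⟩
  -- The height `t` sits on the second factor at `s = 0` and on the first at `s = t`.
  have key : ∫ x, Q x 0 = ∫ x, Q x t := by
    rw [hfub 0 h0t, hfub t htt]
    refine integral_congr_ae ?_
    filter_upwards [hae 0 h0t, hae t htt, hstrip.prod_right_ae] with x hx0 hxt hxs
    have hg : ∀ ξ s : ℝ, Q (e (ξ, x)) s = stripProduct F j y y' t x (ξ + s * I) :=
      fun ξ s => (stripProduct_apply j y y' t ξ s x).symm
    simp only [hg] at hx0 hxt hxs ⊢
    simp only [ofReal_zero, zero_mul, add_zero] at hx0 ⊢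
    exact integral_horizontal_eq ht (hF.differentiableOn_stripProduct hy hy' j t x) hxs hx0 hxt
  simpa [hQ] using key.symm

end Shift

/-! ### Existence of the limit function. -/

section Existence

variable {n : ℕ} {F : (Fin n → ℂ) → ℂ}

open Classical in
/-- The slice `x ↦ F(x + i y)` as an element of `L²`. -/
noncomputable def slice (F : (Fin n → ℂ) → ℂ) (y : Fin n → ℝ) :
    Lp ℂ 2 (volume : Measure (Fin n → ℝ)) :=
  if h : MemLp (fun x => F (cpoint x y)) 2 volume then h.toLp _ else 0

theorem MemH2.slice_eq (hF : MemH2 F) {y : Fin n → ℝ} (hy : y ∈ octant n) :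
    slice F y = (hF.memLp_slice hy).toLp _ := dif_pos _

theorem MemH2.inner_slice (hF : MemH2 F) {y y' : Fin n → ℝ} (hy : y ∈ octant n)
    (hy' : y' ∈ octant n) :
    inner ℂ (slice F y) (slice F y') = ∫ x, F (cpoint x y') * conj (F (cpoint x y)) := by
  rw [hF.slice_eq hy, hF.slice_eq hy', L2.inner_def]
  refine integral_congr_ae ?_
  filter_upwards [(hF.memLp_slice hy).coeFn_toLp, (hF.memLp_slice hy').coeFn_toLp] with x h1 h2
  rw [h1, h2]
  rfl

theorem MemH2.innerShift_slice (hF : MemH2 F) : InnerShift (slice F) := by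
  intro j t ht y hy y' hy'
  obtain _ | m := n
  · exact j.elim0
  -- The inner product is conjugate-linear in its first argument, so `y` and `y'` exchange roles in
  -- `integral_shift`.
  rw [hF.inner_slice (add_single_mem_octant hy j ht) hy',
    hF.inner_slice hy (add_single_mem_octant hy' j ht), hF.integral_shift hy' hy j ht]

theorem MemH2.enorm_slice_sq (hF : MemH2 F) {y : Fin n → ℝ} (hy : y ∈ octant n) :
    ‖slice F y‖ₑ ^ 2 = ∫⁻ x, ‖F (cpoint x y)‖ₑ ^ 2 := by
  rw [hF.slice_eq hy, Lp.enorm_toLp, eLpNorm_two_sq]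

theorem MemH2.norm_slice_sq_le (hF : MemH2 F) {y : Fin n → ℝ} (hy : y ∈ octant n) :
    ‖slice F y‖ ^ 2 ≤ (h2NormSq F).toReal := by
  rw [← ENNReal.ofReal_le_iff_le_toReal hF.2.ne, ENNReal.ofReal_pow (norm_nonneg _),
    ofReal_norm, hF.enorm_slice_sq hy]
  exact lintegral_slice_le F hy

theorem MemH2.exists_isLimitFunction (hF : MemH2 F) : ∃ f, IsLimitFunction F f := by
  obtain ⟨f, hf⟩ := hF.innerShift_slice.exists_tendsto fun y hy => hF.norm_slice_sq_le hy
  refine ⟨f, Lp.memLp f, ?_⟩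
  have h := tendsto_iff_edist_tendsto_0.1 hf
  refine h.congr' ?_
  filter_upwards [self_mem_nhdsWithin] with y hy
  rw [hF.slice_eq hy, Lp.edist_def]
  refine eLpNorm_congr_ae ?_
  filter_upwards [(hF.memLp_slice hy).coeFn_toLp] with x hx
  simp [hx]

theorem MemH2.isLimitFunction (hF : MemH2 F) : IsLimitFunction F (limitFunction F) := by
  have h := hF.exists_isLimitFunction
  rw [limitFunction, dif_pos h]
  exact h.choose_spec

end Existence

end HardyTube

namespace HardyTube

/-! ### The explicit form of the differentiated kernel. -/

section Derivatives

variable {n : ℕ}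

theorem partialX_prod (j : Fin n) (h : Fin n → ℝ → ℂ) :
    partialX j (fun x => ∏ k, h k (x k))
      = fun x => ∏ k, Function.update h j (deriv (h j)) k (x k) := by
  ext x
  have e : (fun t : ℝ => ∏ k, h k (Function.update x j t k))
      = fun t => (∏ k ∈ Finset.univ.erase j, h k (x k)) * h j t := by
    ext t
    rw [← Finset.prod_erase_mul _ _ (Finset.mem_univ j), Function.update_self]
    congr 1
    exact Finset.prod_congr rfl fun k hk => by
      rw [Function.update_of_ne (Finset.ne_of_mem_erase hk)]
  -- Over a field a constant factor leaves `deriv` without any differentiability assumption, so the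
  -- formula holds for arbitrary factors.
  rw [partialX, e, deriv_const_mul_field, ← Finset.prod_erase_mul _ _ (Finset.mem_univ j),
    Function.update_self]
  congr 1
  exact Finset.prod_congr rfl fun k hk => by
    rw [Function.update_of_ne (Finset.ne_of_mem_erase hk)]

theorem partialX_iterate_prod (j : Fin n) (m : ℕ) (h : Fin n → ℝ → ℂ) :
    (partialX j)^[m] (fun x => ∏ k, h k (x k))
      = fun x => ∏ k, Function.update h j (deriv^[m] (h j)) k (x k) := by
  induction m with
  | zero => simp
  | succ m ih =>
    rw [Function.iterate_succ_apply', ih, partialX_prod, Function.update_self,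
      Function.update_idem, Function.iterate_succ_apply']

theorem multiPartial_prod (α : Fin n → ℕ) (h : Fin n → ℝ → ℂ) :
    multiPartial α (fun x => ∏ k, h k (x k)) = fun x => ∏ k, deriv^[α k] (h k) (x k) := by
  have key : ∀ l : List (Fin n), l.Nodup →
      l.foldr (fun j g => (partialX j)^[α j] g) (fun x => ∏ k, h k (x k))
        = fun x => ∏ k, (if k ∈ l then deriv^[α k] (h k) else h k) (x k) := by
    intro l hl
    induction l with
    | nil => simp
    | cons j l ih =>
      obtain ⟨hj, hl⟩ := List.nodup_cons.1 hl
      rw [List.foldr_cons, ih hl,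
        partialX_iterate_prod j (α j) fun k => if k ∈ l then deriv^[α k] (h k) else h k]
      ext x
      refine Finset.prod_congr rfl fun k _ => ?_
      rcases eq_or_ne k j with rfl | hk
      · simp [hj]
      · simp [hk]
  rw [multiPartial, key _ (List.nodup_finRange n)]
  simp

/-- The derivative of order `a` of the one-variable kernel, `u = w - conj z`. -/
noncomputable def kernelDeriv (a : ℕ) (u : ℂ) : ℂ :=
  -(a.factorial : ℂ) / (2 * (Real.pi : ℂ) * Complex.I * u ^ (a + 1))

theorem differentiableAt_kernelDeriv (a : ℕ) {u : ℂ} (hu : u ≠ 0) :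
    DifferentiableAt ℂ (kernelDeriv a) u := by
  unfold kernelDeriv
  refine DifferentiableAt.div (by fun_prop) (by fun_prop) ?_
  exact mul_ne_zero Complex.two_pi_I_ne_zero (pow_ne_zero _ hu)

theorem hasDerivAt_kernelDeriv (a : ℕ) {c : ℂ} {t : ℝ} (hc : c - t ≠ 0) :
    HasDerivAt (fun t : ℝ => kernelDeriv a (c - t)) (kernelDeriv (a + 1) (c - t)) t := by
  have h1 : HasDerivAt (fun t : ℝ => c - (t : ℂ)) (-1) t :=
    (Complex.ofRealCLM.hasDerivAt (x := t)).const_sub c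
  have h2 := (h1.fun_pow (a + 1)).const_mul (2 * (Real.pi : ℂ) * Complex.I)
  have hne : 2 * (Real.pi : ℂ) * Complex.I * (c - t) ^ (a + 1) ≠ 0 :=
    mul_ne_zero Complex.two_pi_I_ne_zero (pow_ne_zero _ hc)
  have h3 := (hasDerivAt_const t (-(a.factorial : ℂ))).fun_div h2 hne
  refine h3.congr_deriv ?_
  have hpi := Complex.two_pi_I_ne_zero
  rw [kernelDeriv, div_eq_div_iff (pow_ne_zero _ hne)
    (mul_ne_zero hpi (pow_ne_zero _ hc)), Nat.factorial_succ]
  push_cast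
  ring

theorem iterate_deriv_kernelDeriv (a : ℕ) {c : ℂ} (hc : c.im ≠ 0) :
    deriv^[a] (fun t : ℝ => kernelDeriv 0 (c - t)) = fun t : ℝ => kernelDeriv a (c - t) := by
  induction a with
  | zero => rfl
  | succ a ih =>
    rw [Function.iterate_succ_apply', ih]
    ext t
    refine (hasDerivAt_kernelDeriv a fun h => hc ?_).deriv
    simpa using congrArg Complex.im h

/-- The explicit form of `φ_{α,z}`. -/
noncomputable def phiExplicit (α : Fin n → ℕ) (z w : Fin n → ℂ) : ℂ :=
  ∏ k, kernelDeriv (α k) (w k - conj (z k))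

theorem szegoKernel_eq (w ζ : Fin n → ℂ) :
    szegoKernel w ζ = ∏ k, kernelDeriv 0 (w k - ζ k) := by
  simp only [szegoKernel, kernelDeriv, Nat.factorial_zero, Nat.cast_one, zero_add, pow_one]

/-- The kernel separates into one-variable factors, each differentiated on its own. Positivity of
the summed imaginary parts keeps every factor away from its pole. -/
theorem phi_eq (α : Fin n → ℕ) {z w : Fin n → ℂ} (h : ∀ k, 0 < (w k).im + (z k).im) :
    phi α z w = phiExplicit α z w := by
  obtain ⟨H, hH⟩ : ∃ H : Fin n → ℝ → ℂ, ∀ k, H k =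
      fun t : ℝ => kernelDeriv 0 (w k + (z k).im * Complex.I - t) := ⟨_, fun _ => rfl⟩
  have e : (fun x : Fin n → ℝ => szegoKernel w fun j => conj (cpoint x (fun k => (z k).im) j))
      = fun x => ∏ k, H k (x k) := by
    ext x
    rw [szegoKernel_eq]
    refine Finset.prod_congr rfl fun k _ => ?_
    rw [hH]
    congr 1
    simp only [cpoint, map_add, map_mul, Complex.conj_ofReal, Complex.conj_I]
    ring
  rw [phi, e, multiPartial_prod, phiExplicit]
  refine Finset.prod_congr rfl fun k _ => ?_
  have hc : (w k + (z k).im * Complex.I).im ≠ 0 := by simpa using (h k).ne'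
  have hk : deriv^[α k] (H k)
      = fun t : ℝ => kernelDeriv (α k) (w k + (z k).im * Complex.I - t) := by
    rw [hH]
    exact iterate_deriv_kernelDeriv (α k) hc
  have hz : w k + (z k).im * Complex.I - (z k).re = w k - conj (z k) := by
    apply Complex.ext <;> simp
  rw [hk, ← hz]

end Derivatives

/-! ### Tonelli for products of one-variable functions. -/

section Product

theorem lintegral_fin_prod {n : ℕ} {f : Fin n → ℝ → ℝ≥0∞} (hf : ∀ k, Measurable (f k)) :
    ∫⁻ x : Fin n → ℝ, ∏ k, f k (x k) = ∏ k, ∫⁻ t, f k t := by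
  induction n with
  | zero => simp [volume_pi]
  | succ n ih =>
    have hem := (volume_preserving_piFinSuccAbove (fun _ : Fin (n + 1) => ℝ) 0).symm _
    rw [← hem.lintegral_comp_emb (MeasurableEquiv.measurableEmbedding _), Fin.prod_univ_succ,
      ← ih fun k => hf k.succ]
    simp only [Fin.prod_univ_succ]
    exact lintegral_prod_mul (μ := volume) (ν := volume) (f := f 0)
      (g := fun x : Fin n → ℝ => ∏ k, f k.succ (x k))
      (hf 0).aemeasurable
      (Finset.measurable_prod _ fun k _ => (hf k.succ).comp (measurable_pi_apply k)).aemeasurable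

/-- Restricting one coordinate only replaces the factor `f j` by its indicator version, so a bound
for one factor passes to the whole product. -/
theorem setLIntegral_fin_prod {n : ℕ} {f : Fin n → ℝ → ℝ≥0∞} (hf : ∀ k, Measurable (f k))
    (j : Fin n) {S : Set ℝ} (hS : MeasurableSet S) {C : ℝ≥0∞}
    (hC : ∫⁻ t in S, f j t ≤ C * ∫⁻ t, f j t) :
    ∫⁻ x in {x : Fin n → ℝ | x j ∈ S}, ∏ k, f k (x k)
      ≤ C * ∫⁻ x : Fin n → ℝ, ∏ k, f k (x k) := by
  have hS' : MeasurableSet {x : Fin n → ℝ | x j ∈ S} := measurable_pi_apply j hS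
  have hm : ∀ k, Measurable (Function.update f j (S.indicator (f j)) k) := by
    intro k
    rcases eq_or_ne k j with rfl | hk
    · simpa using (hf k).indicator hS
    · simpa [hk] using hf k
  have e : ∀ x : Fin n → ℝ, {x : Fin n → ℝ | x j ∈ S}.indicator (fun x => ∏ k, f k (x k)) x
      = ∏ k, Function.update f j (S.indicator (f j)) k (x k) := by
    intro x
    rw [← Finset.mul_prod_erase Finset.univ _ (Finset.mem_univ j), Function.update_self,
      Finset.prod_congr rfl fun k hk => by rw [Function.update_of_ne (Finset.ne_of_mem_erase hk)]]
    by_cases hx : x j ∈ S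
    · rw [Set.indicator_of_mem (by exact hx), Set.indicator_of_mem hx,
        Finset.mul_prod_erase Finset.univ (fun k => f k (x k)) (Finset.mem_univ j)]
    · rw [Set.indicator_of_notMem (by exact hx), Set.indicator_of_notMem hx, zero_mul]
  rw [← lintegral_indicator hS', lintegral_congr e, lintegral_fin_prod hm, lintegral_fin_prod hf,
    ← Finset.mul_prod_erase Finset.univ _ (Finset.mem_univ j),
    ← Finset.mul_prod_erase Finset.univ (fun k => ∫⁻ t, f k t) (Finset.mem_univ j),
    Function.update_self, lintegral_indicator hS, ← mul_assoc,
    Finset.prod_congr rfl fun k hk => by rw [Function.update_of_ne (Finset.ne_of_mem_erase hk)]]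
  gcongr

end Product

/-! ### Estimates for the one-variable kernel. -/

section OneVariable

/-- The squared modulus of the one-variable kernel at `u + i s`. -/
noncomputable def kernelSq (a : ℕ) (s u : ℝ) : ℝ≥0∞ := ‖kernelDeriv a (u + s * Complex.I)‖ₑ ^ 2

/-- The constant in `kernelSq_eq`. -/
noncomputable def kernelConst (a : ℕ) : ℝ := (a.factorial / (2 * Real.pi)) ^ 2

theorem kernelConst_pos (a : ℕ) : 0 < kernelConst a := by
  unfold kernelConst; positivity

theorem kernelSq_eq (a : ℕ) (s u : ℝ) :
    kernelSq a s u = ENNReal.ofReal (kernelConst a / (u ^ 2 + s ^ 2) ^ (a + 1)) := by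
  have h : ‖(u : ℂ) + s * Complex.I‖ ^ 2 = u ^ 2 + s ^ 2 := by
    rw [Complex.sq_norm, Complex.normSq_add_mul_I]
  rw [kernelSq, ← ofReal_norm, ← ENNReal.ofReal_pow (norm_nonneg _), kernelConst, ← h]
  congr 1
  simp only [kernelDeriv, norm_div, norm_neg, norm_mul, norm_pow, Complex.norm_natCast,
    Complex.norm_I, Complex.norm_real, Complex.norm_ofNat, mul_one, Real.norm_eq_abs,
    abs_of_pos Real.pi_pos]
  rw [div_pow, div_pow, mul_pow, div_div, ← pow_mul, ← pow_mul, mul_comm 2 (a + 1)]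

theorem measurable_kernelSq (a : ℕ) (s : ℝ) : Measurable (kernelSq a s) := by
  have : kernelSq a s = fun u =>
      ENNReal.ofReal (kernelConst a / (u ^ 2 + s ^ 2) ^ (a + 1)) := funext (kernelSq_eq a s)
  rw [this]
  fun_prop

theorem kernelSq_anti (a : ℕ) {s s' : ℝ} (hs : 0 < s) (h : s ≤ s') (u : ℝ) :
    kernelSq a s' u ≤ kernelSq a s u := by
  rw [kernelSq_eq, kernelSq_eq]
  have := (kernelConst_pos a).le
  gcongr

theorem lintegral_kernelSq_lt_top (a : ℕ) {s : ℝ} (hs : 0 < s) : ∫⁻ u, kernelSq a s u < ∞ := by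
  have hint : Integrable fun u : ℝ => kernelConst a / (s ^ 2) ^ (a + 1) * (1 + (u / s) ^ 2)⁻¹ :=
    (integrable_inv_one_add_sq.comp_div hs.ne').const_mul _
  refine lt_of_le_of_lt (lintegral_mono fun u => ?_) hint.lintegral_lt_top
  rw [kernelSq_eq]
  refine ENNReal.ofReal_le_ofReal ?_
  have hpos := kernelConst_pos a
  have e : u ^ 2 + s ^ 2 = s ^ 2 * (1 + (u / s) ^ 2) := by field_simp; ring
  have h1 : 1 ≤ 1 + (u / s) ^ 2 := by nlinarith [sq_nonneg (u / s)]
  rw [e, mul_pow, ← div_div, div_eq_mul_inv (kernelConst a / (s ^ 2) ^ (a + 1))]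
  gcongr
  exact le_self_pow₀ h1 (Nat.succ_ne_zero a)

/-- On `[-s, s]` one has `u² + s² ≤ 2s²`. The resulting bound has the right order in `s`, which is
what makes the later comparison uniform in the height. -/
theorem le_lintegral_kernelSq (a : ℕ) {s : ℝ} (hs : 0 < s) :
    ENNReal.ofReal (kernelConst a / (2 * s ^ 2) ^ (a + 1) * (2 * s)) ≤ ∫⁻ u, kernelSq a s u := by
  have hpos := kernelConst_pos a
  calc _ = ∫⁻ _ in Set.Icc (-s) s, ENNReal.ofReal (kernelConst a / (2 * s ^ 2) ^ (a + 1)) := by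
        rw [setLIntegral_const, Real.volume_Icc, ENNReal.ofReal_mul (by positivity)]
        congr 2; ring
    _ ≤ ∫⁻ u in Set.Icc (-s) s, kernelSq a s u := by
        refine setLIntegral_mono (measurable_kernelSq a s) fun u hu => ?_
        rw [kernelSq_eq]
        have : u ^ 2 ≤ s ^ 2 := sq_le_sq' hu.1 hu.2
        refine ENNReal.ofReal_le_ofReal ?_
        gcongr
        linarith
    _ ≤ _ := setLIntegral_le_lintegral _ _

theorem lintegral_kernelSq_pos (a : ℕ) {s : ℝ} (hs : 0 < s) : 0 < ∫⁻ u, kernelSq a s u := by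
  have hpos := kernelConst_pos a
  exact lt_of_lt_of_le (ENNReal.ofReal_pos.2 (by positivity)) (le_lintegral_kernelSq a hs)

theorem lintegral_kernelSq_sub (a : ℕ) (s x : ℝ) :
    ∫⁻ ξ, kernelSq a s (ξ - x) = ∫⁻ u, kernelSq a s u :=
  lintegral_sub_right_eq_self (kernelSq a s) x

/-- The mass of the kernel on `[-A, A]` is a small part of the total mass when the kernel is centred
far away, uniformly in the height `s`. -/
theorem setLIntegral_kernelSq_le (a : ℕ) {s x A T δ : ℝ} (hs : 0 < s) (hA : 0 < A) (hT : 0 < T)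
    (hδ : 2 ^ a * A ≤ δ * T) (hx : A + T ≤ |x|) :
    ∫⁻ ξ in Set.Icc (-A) A, kernelSq a s (ξ - x)
      ≤ ENNReal.ofReal δ * ∫⁻ ξ, kernelSq a s (ξ - x) := by
  have hpos := kernelConst_pos a
  have hδ0 : 0 < δ := by
    by_contra! h
    have : 0 < 2 ^ a * A := by positivity
    nlinarith
  rw [lintegral_kernelSq_sub]
  refine le_trans ?_ (mul_le_mul_right (le_lintegral_kernelSq a hs) _)
  calc _ ≤ ∫⁻ _ in Set.Icc (-A) A, ENNReal.ofReal (kernelConst a / (T ^ 2 + s ^ 2) ^ (a + 1)) := by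
        refine setLIntegral_mono measurable_const fun ξ hξ => ?_
        rw [kernelSq_eq]
        have h1 : T ≤ |ξ - x| := by
          have h2 : |ξ| ≤ A := abs_le.2 hξ
          have h3 := abs_sub_abs_le_abs_sub x ξ
          rw [abs_sub_comm] at h3
          linarith
        have : T ^ 2 ≤ (ξ - x) ^ 2 := by
          rw [← sq_abs (ξ - x)]; gcongr
        refine ENNReal.ofReal_le_ofReal ?_
        gcongr
    _ ≤ _ := by
        rw [setLIntegral_const, Real.volume_Icc, ← ENNReal.ofReal_mul (by positivity),
          ← ENNReal.ofReal_mul hδ0.le]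
        refine ENNReal.ofReal_le_ofReal ?_
        -- One factor is bounded below by `2Ts` (AM-GM) and the other `a` by `s²`. The powers of `s`
        -- then match those of the total mass, leaving the ratio `2^a A / T`, independent of `s`.
        have h1 : (s ^ 2) ^ a * (2 * T * s) ≤ (T ^ 2 + s ^ 2) ^ (a + 1) := by
          rw [pow_succ (T ^ 2 + s ^ 2)]
          have : s ^ 2 ≤ T ^ 2 + s ^ 2 := by nlinarith [sq_nonneg T]
          gcongr
          nlinarith [sq_nonneg (T - s)]
        calc kernelConst a / (T ^ 2 + s ^ 2) ^ (a + 1) * (A - -A)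
            ≤ kernelConst a / ((s ^ 2) ^ a * (2 * T * s)) * (2 * A) := by
              rw [sub_neg_eq_add, ← two_mul]
              gcongr
          _ = 2 ^ a * A * (kernelConst a / ((s ^ 2) ^ a * (T * s) * 2 ^ a)) := by
              field_simp
          _ ≤ δ * T * (kernelConst a / ((s ^ 2) ^ a * (T * s) * 2 ^ a)) :=
              mul_le_mul_of_nonneg_right hδ (by positivity)
          _ = δ * (kernelConst a / (2 * s ^ 2) ^ (a + 1) * (2 * s)) := by
              rw [mul_pow, pow_succ 2, pow_succ (s ^ 2)]
              field_simp

end OneVariable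

end HardyTube

namespace HardyTube

variable {n : ℕ}

/-! ### Membership of `φ_{α,z}` in the Hardy space and positivity of its norm. -/

section Phi

theorem enorm_phiExplicit_sq (α : Fin n → ℕ) (x y ξ η : Fin n → ℝ) :
    ‖phiExplicit α (cpoint x y) (cpoint ξ η)‖ₑ ^ 2
      = ∏ k, kernelSq (α k) (η k + y k) (ξ k - x k) := by
  have h : ∀ k, cpoint ξ η k - conj (cpoint x y k)
      = ((ξ k - x k : ℝ) : ℂ) + ((η k + y k : ℝ) : ℂ) * Complex.I := by
    intro k
    simp only [cpoint, map_add, map_mul, Complex.conj_ofReal, Complex.conj_I]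
    push_cast
    ring
  simp only [phiExplicit, h, kernelSq, enorm_eq_nnnorm, nnnorm_prod, ENNReal.ofNNReal_finsetProd,
    Finset.prod_pow]

theorem lintegral_phiExplicit (α : Fin n → ℕ) (x y η : Fin n → ℝ) :
    ∫⁻ ξ : Fin n → ℝ, ‖phiExplicit α (cpoint x y) (cpoint ξ η)‖ₑ ^ 2
      = ∏ k, ∫⁻ u, kernelSq (α k) (η k + y k) u := by
  simp only [enorm_phiExplicit_sq]
  rw [lintegral_fin_prod (f := fun k t => kernelSq (α k) (η k + y k) (t - x k))
    fun k => (measurable_kernelSq _ _).comp (measurable_id.sub_const _)]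
  simp only [lintegral_kernelSq_sub]

theorem phi_cpoint_eq (α : Fin n → ℕ) (x : Fin n → ℝ) {y η : Fin n → ℝ} (hy : y ∈ octant n)
    (hη : η ∈ octant n) (ξ : Fin n → ℝ) :
    phi α (cpoint x y) (cpoint ξ η) = phiExplicit α (cpoint x y) (cpoint ξ η) :=
  phi_eq α fun k => by
    have := hy k; have := hη k
    simp only [cpoint, Complex.add_im, Complex.ofReal_im, Complex.mul_im, Complex.I_im,
      Complex.I_re, Complex.ofReal_re]
    linarith

theorem phiExplicit_differentiableAt (α : Fin n → ℕ) {z w : Fin n → ℂ}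
    (h : ∀ k, 0 < (w k).im + (z k).im) : DifferentiableAt ℂ (phiExplicit α z) w := by
  unfold phiExplicit
  refine (HasFDerivAt.finsetProd
    (g := fun k (w : Fin n → ℂ) => kernelDeriv (α k) (w k - conj (z k)))
    fun k _ => DifferentiableAt.hasFDerivAt ?_).differentiableAt
  have hne : w k - conj (z k) ≠ 0 := fun h0 => (h k).ne' (by
    simpa using congrArg Complex.im h0)
  exact (differentiableAt_kernelDeriv (α k) hne).comp w (f := fun w : Fin n → ℂ => w k - conj (z k))
    (by fun_prop)

theorem cpoint_re_im (z : Fin n → ℂ) :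
    cpoint (fun j => (z j).re) (fun j => (z j).im) = z :=
  funext fun j => Complex.re_add_im (z j)

/-- Each kernel factor decreases as the height grows, so the slice at `η` is dominated by the
boundary expression `η = 0`. -/
theorem h2NormSq_phi_le (α : Fin n → ℕ) (x : Fin n → ℝ) {y : Fin n → ℝ} (hy : y ∈ octant n) :
    h2NormSq (phi α (cpoint x y)) ≤ ∏ k, ∫⁻ u, kernelSq (α k) (y k) u := by
  refine iSup₂_le fun η hη => ?_
  rw [lintegral_congr fun ξ => by rw [phi_cpoint_eq α x hy hη ξ], lintegral_phiExplicit]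
  refine Finset.prod_le_prod' fun k _ => lintegral_mono fun u => ?_
  exact kernelSq_anti _ (hy k) (le_add_of_nonneg_left (hη k).le) u

theorem memH2_phi (α : Fin n → ℕ) {z : Fin n → ℂ} (hz : z ∈ tube (octant n)) :
    MemH2 (phi α z) := by
  refine ⟨fun w hw => ?_, ?_⟩
  · have hd := phiExplicit_differentiableAt α (z := z) (w := w) fun k => add_pos (hw k) (hz k)
    exact hd.differentiableWithinAt.congr
      (fun w' hw' => phi_eq α fun k => add_pos (hw' k) (hz k))
      (phi_eq α fun k => add_pos (hw k) (hz k))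
  · have h := h2NormSq_phi_le α (fun j => (z j).re) (y := fun j => (z j).im) hz
    rw [cpoint_re_im] at h
    exact h.trans_lt (ENNReal.prod_lt_top fun k _ => lintegral_kernelSq_lt_top _ (hz k))

theorem h2NormSq_phi_pos (α : Fin n → ℕ) {z : Fin n → ℂ} (hz : z ∈ tube (octant n)) :
    0 < h2NormSq (phi α z) := by
  set y : Fin n → ℝ := fun j => (z j).im with hy
  have hyo : y ∈ octant n := hz
  refine lt_of_lt_of_le ?_ (lintegral_slice_le (phi α z) hyo)
  rw [← cpoint_re_im z, lintegral_congr fun ξ => by rw [phi_cpoint_eq α _ hyo hyo ξ],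
    lintegral_phiExplicit]
  exact pos_iff_ne_zero.2 (Finset.prod_ne_zero_iff.2 fun k _ =>
    (lintegral_kernelSq_pos _ (add_pos (hyo k) (hyo k))).ne')

theorem h2Norm_phi_pos (α : Fin n → ℕ) {z : Fin n → ℂ} (hz : z ∈ tube (octant n)) :
    0 < h2Norm (phi α z) :=
  Real.sqrt_pos.2 (ENNReal.toReal_pos (h2NormSq_phi_pos α hz).ne' (memH2_phi α hz).2.ne)

end Phi

/-! ### Boundary values and the decay estimate. -/

section Limit

variable {F : (Fin n → ℂ) → ℂ} {f : (Fin n → ℝ) → ℂ}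

theorem MemH2.ofReal_h2Norm_sq (hF : MemH2 F) : ENNReal.ofReal (h2Norm F) ^ 2 = h2NormSq F := by
  rw [h2Norm, ← ENNReal.ofReal_pow (Real.sqrt_nonneg _), Real.sq_sqrt ENNReal.toReal_nonneg,
    ENNReal.ofReal_toReal hF.2.ne]

theorem MemH2.eLpNorm_slice_le (hF : MemH2 F) {y : Fin n → ℝ} (hy : y ∈ octant n) :
    eLpNorm (fun x => F (cpoint x y)) 2 volume ≤ ENNReal.ofReal (h2Norm F) := by
  rw [← ENNReal.pow_le_pow_left_iff two_ne_zero, hF.ofReal_h2Norm_sq, eLpNorm_two_sq]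
  exact lintegral_slice_le F hy

theorem IsLimitFunction.eLpNorm_le (h : IsLimitFunction F f) (hF : MemH2 F) :
    eLpNorm f 2 volume ≤ ENNReal.ofReal (h2Norm F) := by
  have := octant_nhdsWithin_neBot n
  have ht := h.2.add_const (ENNReal.ofReal (h2Norm F))
  rw [zero_add] at ht
  refine ge_of_tendsto ht ?_
  filter_upwards [self_mem_nhdsWithin] with η hη
  have hm := hF.memLp_slice hη
  have e : f = fun ξ => F (cpoint ξ η) - (F (cpoint ξ η) - f ξ) := by ext; simp
  calc eLpNorm f 2 volume
      ≤ eLpNorm (fun x => F (cpoint x η)) 2 volume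
        + eLpNorm (fun ξ => F (cpoint ξ η) - f ξ) 2 volume := by
        conv_lhs => rw [e]
        exact eLpNorm_sub_le hm.1 (hm.1.sub h.1.1) one_le_two
    _ ≤ _ := by
        rw [add_comm]
        gcongr
        exact hF.eLpNorm_slice_le hη

/-- Along a sequence of heights tending to `0`, `L²` convergence gives almost everywhere convergence
of a subsequence, so a pointwise limit must agree with the limit function. -/
theorem IsLimitFunction.ae_eq_of_tendsto (h : IsLimitFunction F f) (hF : MemH2 F)
    {g : (Fin n → ℝ) → ℂ}
    (hg : ∀ ξ, Tendsto (fun η => F (cpoint ξ η)) (𝓝[octant n] 0) (𝓝 (g ξ))) : f =ᵐ[volume] g := by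
  have := octant_nhdsWithin_neBot n
  set s : ℕ → Fin n → ℝ := fun k _ => (1 : ℝ) / ((k : ℝ) + 1) with hs
  have hso : ∀ k, s k ∈ octant n := fun k j => by simp only [hs]; positivity
  have hs0 : Tendsto s atTop (𝓝[octant n] 0) :=
    tendsto_nhdsWithin_iff.2 ⟨tendsto_pi_nhds.2 fun _ => tendsto_one_div_add_atTop_nhds_zero_nat,
      Eventually.of_forall hso⟩
  have hm : TendstoInMeasure volume (fun k ξ => F (cpoint ξ (s k))) atTop f :=
    tendstoInMeasure_of_tendsto_eLpNorm two_ne_zero (fun k => (hF.memLp_slice (hso k)).1) h.1.1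
      (h.2.comp hs0)
  obtain ⟨ns, hns, hae⟩ := hm.exists_seq_tendsto_ae
  filter_upwards [hae] with ξ hξ
  exact tendsto_nhds_unique hξ ((hg ξ).comp (hs0.comp hns.tendsto_atTop))

theorem limitFunction_phi (α : Fin n → ℕ) (x : Fin n → ℝ) {y : Fin n → ℝ} (hy : y ∈ octant n) :
    limitFunction (phi α (cpoint x y))
      =ᵐ[volume] fun ξ => phiExplicit α (cpoint x y) (cpoint ξ 0) := by
  have hF := memH2_phi α (cpoint_mem_tube (x := x).2 hy)
  refine hF.isLimitFunction.ae_eq_of_tendsto hF fun ξ => ?_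
  have hd : ContinuousAt (phiExplicit α (cpoint x y)) (cpoint ξ 0) :=
    (phiExplicit_differentiableAt α fun k => by
      simpa [cpoint] using hy k).continuousAt
  have hc : ContinuousAt (fun η => cpoint ξ η) 0 :=
    (continuous_cpoint.comp (Continuous.prodMk continuous_const continuous_id)).continuousAt
  have ht : Tendsto (fun η => phiExplicit α (cpoint x y) (cpoint ξ η)) (𝓝[octant n] 0)
      (𝓝 (phiExplicit α (cpoint x y) (cpoint ξ 0))) :=
    (ContinuousAt.comp (f := fun η => cpoint ξ η) hd hc).tendsto.mono_left nhdsWithin_le_nhds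
  refine ht.congr' ?_
  filter_upwards [self_mem_nhdsWithin] with η hη
  exact (phi_cpoint_eq α x hy hη ξ).symm

/-- On a fixed cube the boundary values of `φ_{α,z}` carry a small part of their total mass when
`x` is large, uniformly in `y`. -/
theorem exists_setLIntegral_phiExplicit_le (α : Fin n → ℕ) {A δ : ℝ} (hA : 0 < A) (hδ : 0 < δ) :
    ∃ R : ℝ, ∀ x : Fin n → ℝ, R < euclNorm x → ∀ y ∈ octant n,
      ∫⁻ ξ in Metric.closedBall 0 A, ‖phiExplicit α (cpoint x y) (cpoint ξ 0)‖ₑ ^ 2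
        ≤ ENNReal.ofReal δ * ∫⁻ ξ, ‖phiExplicit α (cpoint x y) (cpoint ξ 0)‖ₑ ^ 2 := by
  -- The exponent `|α|` serves every coordinate at once, whichever turns out to be large. The radius
  -- `√n (A + T)` forces some `|x k| ≥ A + T`.
  set T : ℝ := 2 ^ (∑ k, α k) * A / δ with hT
  have hT0 : 0 < T := by positivity
  refine ⟨Real.sqrt (n * (A + T) ^ 2), fun x hx y hy => ?_⟩
  obtain ⟨k, hk⟩ : ∃ k, A + T ≤ |x k| := by
    by_contra! h
    refine hx.not_ge (Real.sqrt_le_sqrt ?_)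
    calc ∑ j, x j ^ 2 ≤ ∑ _j : Fin n, (A + T) ^ 2 := Finset.sum_le_sum fun j _ => by
          rw [← sq_abs (x j)]
          have := h j
          gcongr
      _ = n * (A + T) ^ 2 := by simp
  have hδT : 2 ^ α k * A ≤ δ * T := by
    have h1 : α k ≤ ∑ k, α k :=
      Finset.single_le_sum (f := α) (fun _ _ => Nat.zero_le _) (Finset.mem_univ k)
    have h2 : δ * T = 2 ^ (∑ k, α k) * A := by rw [hT]; field_simp
    rw [h2]
    gcongr
    norm_num
  have hsub : Metric.closedBall (0 : Fin n → ℝ) A ⊆ {ξ | ξ k ∈ Set.Icc (-A) A} := by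
    intro ξ hξ
    have h1 := (norm_le_pi_norm ξ k).trans (mem_closedBall_zero_iff.1 hξ)
    exact abs_le.1 h1
  refine (lintegral_mono_set hsub).trans ?_
  simp only [enorm_phiExplicit_sq, Pi.zero_apply, zero_add]
  exact setLIntegral_fin_prod (f := fun k t => kernelSq (α k) (y k) (t - x k))
    (fun k => (measurable_kernelSq _ _).comp (measurable_id.sub_const _)) k measurableSet_Icc
    (setLIntegral_kernelSq_le (α k) (hy k) hA hT0 hδT hk)

theorem lintegral_mul_conj_le_eLpNorm {β : Type*} [MeasurableSpace β] {μ : Measure β} {f g : β → ℂ}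
    (hf : AEStronglyMeasurable f μ) (hg : AEStronglyMeasurable g μ) :
    ∫⁻ ξ, ‖f ξ * conj (g ξ)‖ₑ ∂μ ≤ eLpNorm f 2 μ * eLpNorm g 2 μ := by
  have hc : ∀ b : ℂ, ‖conj b‖ₑ = ‖b‖ₑ := fun b => by simp [← ofReal_norm]
  have h := ENNReal.lintegral_mul_le_Lp_mul_Lq μ (p := 2) (q := 2)
    (by constructor <;> norm_num) hf.enorm hg.enorm
  simp only [enorm_mul, hc]
  simpa [eLpNorm_eq_lintegral_rpow_enorm_toReal] using h

/-- Compactly supported functions approximate `f` in `L²`, and off a ball containing the support of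
the approximant `g` one has `f = f - g`. -/
theorem exists_eLpNorm_compl_closedBall_le (hf : MemLp f 2 volume) {ε : ℝ≥0∞}
    (hε : ε ≠ 0) :
    ∃ A : ℝ, 0 < A ∧ eLpNorm f 2 (volume.restrict (Metric.closedBall 0 A)ᶜ) ≤ ε := by
  obtain ⟨g, hg, hle, -, -⟩ := hf.exists_hasCompactSupport_eLpNorm_sub_le ENNReal.ofNat_ne_top hε
  obtain ⟨A, hA⟩ := hg.isCompact.isBounded.subset_closedBall 0
  refine ⟨max A 1, lt_max_of_lt_right one_pos, ?_⟩
  refine le_trans (le_of_eq ?_) ((eLpNorm_restrict_le (f - g) 2 volume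
    (Metric.closedBall 0 (max A 1))ᶜ).trans hle)
  refine eLpNorm_congr_ae ?_
  refine (ae_restrict_iff' Metric.isClosed_closedBall.measurableSet.compl).2
    (Eventually.of_forall fun ξ hξ => ?_)
  have : g ξ = 0 := image_eq_zero_of_notMem_tsupport fun h =>
    hξ (Metric.closedBall_subset_closedBall (le_max_left _ _) (hA h))
  simp [this]

theorem norm_h2Inner_phi_le (hF : MemH2 F) (α : Fin n → ℕ) {x y : Fin n → ℝ}
    (hy : y ∈ octant n) {A δ ε : ℝ} (hδ : 0 ≤ δ) (hε : 0 ≤ ε)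
    (htail : eLpNorm (limitFunction F) 2 (volume.restrict (Metric.closedBall 0 A)ᶜ)
      ≤ ENNReal.ofReal ε)
    (hcube : ∫⁻ ξ in Metric.closedBall 0 A, ‖phiExplicit α (cpoint x y) (cpoint ξ 0)‖ₑ ^ 2
        ≤ ENNReal.ofReal (δ ^ 2) * ∫⁻ ξ, ‖phiExplicit α (cpoint x y) (cpoint ξ 0)‖ₑ ^ 2) :
    ‖h2Inner F (phi α (cpoint x y))‖
      ≤ (h2Norm F * δ + ε) * h2Norm (phi α (cpoint x y)) := by
  set G := phi α (cpoint x y) with hG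
  have hGm : MemH2 G := memH2_phi α (cpoint_mem_tube.2 hy)
  set f := limitFunction F
  set g := limitFunction G
  have hf := hF.isLimitFunction
  have hg := hGm.isLimitFunction
  have hN : 0 ≤ h2Norm F := Real.sqrt_nonneg _
  have hNG : 0 ≤ h2Norm G := Real.sqrt_nonneg _
  have hae : g =ᵐ[volume] fun ξ => phiExplicit α (cpoint x y) (cpoint ξ 0) :=
    limitFunction_phi α x hy
  have hgB : eLpNorm g 2 (volume.restrict (Metric.closedBall 0 A))
      ≤ ENNReal.ofReal (δ * h2Norm G) := by
    rw [← ENNReal.pow_le_pow_left_iff two_ne_zero, ENNReal.ofReal_mul hδ, mul_pow,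
      ← ENNReal.ofReal_pow hδ, eLpNorm_two_sq,
      lintegral_congr_ae ((ae_restrict_of_ae hae).mono fun ξ hξ => by rw [hξ])]
    refine hcube.trans (mul_le_mul_right ?_ _)
    rw [lintegral_congr_ae (g := fun ξ => ‖g ξ‖ₑ ^ 2) (hae.mono fun ξ hξ => by
        change _ = ‖g ξ‖ₑ ^ 2
        rw [hξ]), ← eLpNorm_two_sq]
    exact pow_le_pow_left' (hg.eLpNorm_le hGm) 2
  have hmeas : MeasurableSet (Metric.closedBall (0 : Fin n → ℝ) A) :=
    Metric.isClosed_closedBall.measurableSet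
  rw [← ENNReal.ofReal_le_ofReal_iff (by positivity), ofReal_norm]
  calc ‖h2Inner F G‖ₑ ≤ ∫⁻ ξ, ‖f ξ * conj (g ξ)‖ₑ := enorm_integral_le_lintegral_enorm _
    _ = (∫⁻ ξ in Metric.closedBall 0 A, ‖f ξ * conj (g ξ)‖ₑ)
        + ∫⁻ ξ in (Metric.closedBall 0 A)ᶜ, ‖f ξ * conj (g ξ)‖ₑ :=
        (lintegral_add_compl _ hmeas).symm
    _ ≤ ENNReal.ofReal (h2Norm F) * ENNReal.ofReal (δ * h2Norm G)
        + ENNReal.ofReal ε * ENNReal.ofReal (h2Norm G) := by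
        refine add_le_add
          ((lintegral_mul_conj_le_eLpNorm hf.1.1.restrict hg.1.1.restrict).trans ?_)
          ((lintegral_mul_conj_le_eLpNorm hf.1.1.restrict hg.1.1.restrict).trans ?_)
        · exact mul_le_mul' ((eLpNorm_restrict_le _ _ _ _).trans (hf.eLpNorm_le hF)) hgB
        · exact mul_le_mul' htail ((eLpNorm_restrict_le _ _ _ _).trans (hg.eLpNorm_le hGm))
    _ = _ := by
        rw [← ENNReal.ofReal_mul hN, ← ENNReal.ofReal_mul hε,
          ← ENNReal.ofReal_add (by positivity) (by positivity)]
        congr 1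
        ring

theorem MemH2.exists_ratio_lt (hF : MemH2 F) (α : Fin n → ℕ) {ε : ℝ} (hε : 0 < ε) :
    ∃ R : ℝ, ∀ x : Fin n → ℝ, R < euclNorm x → ∀ y ∈ octant n,
      ‖h2Inner F (phi α (cpoint x y))‖ / h2Norm (phi α (cpoint x y)) < ε := by
  have hN : 0 ≤ h2Norm F := Real.sqrt_nonneg _
  obtain ⟨A, hA, htail⟩ := exists_eLpNorm_compl_closedBall_le hF.isLimitFunction.1
    (ε := ENNReal.ofReal (ε / 2)) (ENNReal.ofReal_pos.2 (half_pos hε)).ne'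
  -- The `+ 1` allows `h2Norm F = 0` and makes `h2Norm F * δ < ε / 2` strict. The mass bound is
  -- requested with `δ ^ 2` because it concerns squared norms.
  set δ : ℝ := ε / 2 / (h2Norm F + 1) with hδ
  have hδ0 : 0 < δ := by positivity
  obtain ⟨R, hR⟩ := exists_setLIntegral_phiExplicit_le α hA (pow_pos hδ0 2)
  refine ⟨R, fun x hx y hy => ?_⟩
  rw [div_lt_iff₀ (h2Norm_phi_pos α (cpoint_mem_tube.2 hy))]
  refine (norm_h2Inner_phi_le hF α hy hδ0.le (half_pos hε).le htail (hR x hx y hy)).trans_lt ?_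
  have h1 : h2Norm F * δ < ε / 2 := by
    rw [hδ, mul_div_assoc', div_lt_iff₀ (by positivity)]
    nlinarith
  have := h2Norm_phi_pos α (cpoint_mem_tube (x := x).2 hy)
  gcongr
  linarith

end Limit

end HardyTube

theorem theorem3p4 (n : ℕ) (F : (Fin n → ℂ) → ℂ) (hF : HardyTube.MemH2 F) (α : Fin n → ℕ) :
    (∃ f, HardyTube.IsLimitFunction F f) ∧
    (∀ z ∈ HardyTube.tube (HardyTube.octant n),
      HardyTube.MemH2 (HardyTube.phi α z) ∧ 0 < HardyTube.h2Norm (HardyTube.phi α z)) ∧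
    (∀ ε : ℝ, 0 < ε → ∃ R : ℝ, ∀ x : Fin n → ℝ, R < HardyTube.euclNorm x →
      ∀ y ∈ HardyTube.octant n,
        ‖HardyTube.h2Inner F (HardyTube.phi α (HardyTube.cpoint x y))‖ /
          HardyTube.h2Norm (HardyTube.phi α (HardyTube.cpoint x y)) < ε) :=
  ⟨hF.exists_isLimitFunction,
    fun _ hz => ⟨HardyTube.memH2_phi α hz, HardyTube.h2Norm_phi_pos α hz⟩,
    fun _ hε => hF.exists_ratio_lt α hε⟩
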